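/- Let $M$ be a monoid and $A$ a set. The shift action of $M$ on the set $A^M$ of all maps $x\colon M\to A$ is given by $(mx)(m') = x(m'm)$ for $m,m'\in M$. Equip $A^M$ with the prodiscrete uniform structure, i.e. the product uniform structure obtained from the discrete uniform structure on each factor $A$. A cellular automaton over $M$ with alphabet $A$ is a map $\tau\colon A^M\to A^M$ that is equivariant, i.e. $\tau(mx)=m\,\tau(x)$ for all $m\in M$ and $x\in A^M$, and uniformly continuous. The monoid $M$ is called surjunctive if, for every finite set $A$, every injective cellular automaton $\tau\colon A^M\to A^M$ is surjective. Corollary. Every finitely generated commutative monoid is surjunctive. -/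

import Mathlib

universe u v

namespace CellularAutomata

/-- The shift of a monoid `M` on the configurations `M → A`: the configuration `m x` is
`x ∘ R_m`, where `R_m` is right multiplication by `m`, that is `(m x)(m') = x (m' * m)`. -/
def shift {M : Type u} [Monoid M] {A : Type v} (m : M) (x : M → A) : M → A :=
  fun m' => x (m' * m)

/-- The prodiscrete uniform structure on `E → A`: the product uniform structure obtained by
taking the discrete uniform structure `⊥` on each factor `A`. -/
abbrev prodiscrete (E : Type u) (A : Type v) : UniformSpace (E → A) :=
  @Pi.uniformSpace E (fun _ => A) (fun _ => ⊥)

/-- A cellular automaton over the monoid `M` and the alphabet `A`: a self-map of the set of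
configurations that commutes with the shift and is uniformly continuous for the prodiscrete
uniform structure. -/
structure IsCellularAutomaton {M : Type u} [Monoid M] {A : Type v}
    (τ : (M → A) → (M → A)) : Prop where
  equivariant : ∀ (m : M) (x : M → A), τ (shift m x) = shift m (τ x)
  uniformContinuous : @UniformContinuous _ _ (prodiscrete M A) (prodiscrete M A) τ

/-- A monoid is surjunctive if every injective cellular automaton with finite alphabet over it
is surjective. -/
def IsSurjunctive (M : Type u) [Monoid M] : Prop :=
  ∀ (A : Type v) [Finite A] (τ : (M → A) → (M → A)),
    IsCellularAutomaton τ → Function.Injective τ → Function.Surjective τ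

end CellularAutomata

/-! Configurations factoring through a homomorphism to a finite monoid form a finite `τ`-stable set,
so an injective `τ` permutes them. When finite subsets of `M` are separated by such homomorphisms,
these configurations are dense; the range of `τ` is compact, hence closed, so it is everything.
Separation comes from finite quotients of the Noetherian ring `MonoidAlgebra (ZMod 2) M`. -/

/-- In a finitely generated commutative algebra over a finite field, every nonzero element survives
in a finite quotient ring. -/
theorem exists_ideal_finite_quotient_notMem {k R : Type*} [Field k] [Finite k] [CommRing R]
    [Algebra k R] [Algebra.FiniteType k R] {x : R} (hx : x ≠ 0) :
    ∃ I : Ideal R, Finite (R ⧸ I) ∧ x ∉ I := by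
  have : IsNoetherianRing R := Algebra.FiniteType.isNoetherianRing k R
  have hann : Submodule.annihilator (Ideal.span {x}) ≠ ⊤ := by
    intro h
    have h1 : (1 : R) ∈ Submodule.annihilator (Ideal.span {x}) := h ▸ Submodule.mem_top
    rw [Submodule.mem_annihilator] at h1
    exact hx (by simpa using h1 x (Ideal.mem_span_singleton_self x))
  obtain ⟨m, hm, hle⟩ := Ideal.exists_le_maximal _ hann
  let _ : Field (R ⧸ m) := Ideal.Quotient.field m
  -- Zariski's lemma: the residue field is finite over `k`.
  have : Module.Finite k (R ⧸ m) := finite_of_finite_type_of_isJacobsonRing k (R ⧸ m)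
  have : Finite (R ⧸ m) := Module.finite_of_finite k
  by_contra! hcon
  have hmem : x ∈ (⨅ i : ℕ, m ^ i • (⊤ : Submodule R R)) := by
    simp only [Submodule.mem_iInf]
    intro i
    simpa using hcon (m ^ i) (Ideal.finite_quotient_pow (IsNoetherian.noetherian m) i)
  -- Krull's intersection theorem gives `r ∈ m` with `r • x = x`, so `1 - r` annihilates `x` and
  -- lies in `m`.
  obtain ⟨r, hr⟩ := (m.mem_iInf_smul_pow_eq_bot_iff x).mp hmem
  have h1 : 1 - (r : R) ∈ m := by
    apply hle
    rw [Submodule.mem_annihilator_span_singleton]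
    rw [sub_smul, one_smul, hr, sub_self]
  exact (Ideal.ne_top_iff_one m).mp hm.ne_top (by simpa using m.add_mem h1 r.2)

/-- Finitely generated commutative monoids are residually finite. -/
theorem CommMonoid.exists_monoidHom_finite_ne {M : Type u} [CommMonoid M] [Monoid.FG M] {a b : M}
    (hab : a ≠ b) : ∃ (F : Type u) (_ : Monoid F) (_ : Finite F) (φ : M →* F), φ a ≠ φ b := by
  have : Fact (Nat.Prime 2) := ⟨Nat.prime_two⟩
  have hx : MonoidAlgebra.of (ZMod 2) M a - MonoidAlgebra.of (ZMod 2) M b ≠ 0 :=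
    sub_ne_zero.mpr (MonoidAlgebra.of_injective.ne hab)
  obtain ⟨I, hI, hxI⟩ := exists_ideal_finite_quotient_notMem (k := ZMod 2) hx
  refine ⟨MonoidAlgebra (ZMod 2) M ⧸ I, inferInstance, hI,
    (Ideal.Quotient.mk I : _ →* _).comp (MonoidAlgebra.of (ZMod 2) M), fun h => hxI ?_⟩
  exact Ideal.Quotient.eq.mp h

/-- A finite set of elements of a finitely generated commutative monoid is separated by a single
homomorphism to a finite monoid. -/
theorem CommMonoid.exists_monoidHom_finite_injOn {M : Type u} [CommMonoid M] [Monoid.FG M]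
    (K : Finset M) :
    ∃ (F : Type u) (_ : Monoid F) (_ : Finite F) (φ : M →* F), Set.InjOn φ K := by
  choose F hF hfin φ hφ using
    fun p : {p : K × K // (p.1 : M) ≠ p.2} => exists_monoidHom_finite_ne p.2
  refine ⟨∀ p, F p, inferInstance, inferInstance, MonoidHom.pi φ, fun a ha b hb h => ?_⟩
  by_contra hab
  exact hφ ⟨(⟨a, ha⟩, ⟨b, hb⟩), hab⟩ (congrFun h _)

namespace CellularAutomata

/-- An equivariant map preserves the configurations that factor through a given monoid
homomorphism. -/
theorem factorsThrough_of_equivariant {M F A : Type*} [Monoid M] [Monoid F] {φ : M →* F}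
    {τ : (M → A) → (M → A)} (hτ : ∀ (m : M) (x : M → A), τ (shift m x) = shift m (τ x))
    {x : M → A} (hx : Function.FactorsThrough x φ) : Function.FactorsThrough (τ x) φ := by
  intro a b hab
  have h : shift a x = shift b x := funext fun m => hx (by simp [hab])
  simpa [hτ, shift] using congrFun (congrArg τ h) 1

/-- An injective equivariant map with finite alphabet maps the configurations that factor through a
homomorphism to a finite monoid onto themselves. -/
theorem image_factorsThrough_eq {M F A : Type*} [Monoid M] [Monoid F] [Finite F] [Finite A]
    (φ : M →* F) {τ : (M → A) → (M → A)}
    (hτ : ∀ (m : M) (x : M → A), τ (shift m x) = shift m (τ x)) (hinj : Function.Injective τ) :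
    τ '' {x | Function.FactorsThrough x φ} = {x | Function.FactorsThrough x φ} := by
  have hfin : {x : M → A | Function.FactorsThrough x φ}.Finite := by
    rcases isEmpty_or_nonempty A with hA | hA
    · exact Set.toFinite _
    · refine (Set.finite_range fun g : F → A => g ∘ φ).subset fun x hx => ?_
      obtain ⟨g, hg⟩ := (Function.factorsThrough_iff x).mp hx
      exact ⟨g, hg.symm⟩
  refine Set.eq_of_subset_of_ncard_le ?_ (Set.ncard_image_of_injective _ hinj).ge hfin
  rintro _ ⟨x, hx, rfl⟩
  exact factorsThrough_of_equivariant hτ hx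

/-- Monoids whose finite subsets are separated by homomorphisms to finite monoids are
surjunctive. -/
theorem isSurjunctive_of_exists_monoidHom_finite_injOn {M : Type u} [Monoid M]
    (hM : ∀ K : Finset M,
      ∃ (F : Type u) (_ : Monoid F) (_ : Finite F) (φ : M →* F), Set.InjOn φ K) :
    IsSurjunctive.{u, v} M := by
  intro A _ τ hτ hinj y
  let _ : UniformSpace A := ⊥
  have : DiscreteTopology A := ⟨rfl⟩
  have hcont : Continuous τ := hτ.uniformContinuous.continuous
  have hclosed : IsClosed (Set.range τ) := (isCompact_range hcont).isClosed
  change y ∈ Set.range τ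
  rw [← hclosed.closure_eq, mem_closure_iff]
  intro o ho hyo
  obtain ⟨K, u, hu, hsub⟩ := isOpen_pi_iff.mp ho y hyo
  obtain ⟨F, _, _, φ, hφ⟩ := hM K
  -- Composing `y` with a section of `φ` over `K` gives a configuration that factors through `φ` and
  -- agrees with `y` on `K`.
  have hx : Function.FactorsThrough (fun m => y (Function.invFunOn φ K (φ m))) φ :=
    fun a b hab => by simp only [hab]
  refine ⟨_, hsub fun m hm => ?_, Set.image_subset_range τ _
    ((image_factorsThrough_eq φ hτ.equivariant hinj).ge hx)⟩
  simpa only [hφ.leftInvOn_invFunOn hm] using (hu m hm).2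

end CellularAutomata

theorem mainTheorem6 (M : Type u) [CommMonoid M] (hM : Monoid.FG M) :
    CellularAutomata.IsSurjunctive.{u, v} M :=
  CellularAutomata.isSurjunctive_of_exists_monoidHom_finite_injOn
    CommMonoid.exists_monoidHom_finite_injOn
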